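/- Let $\mathbf A=\langle A,\wedge,\vee,\ldots\rangle$ be a finite lattice algebra, that is, a finite non-empty lattice, possibly with additional finitary operations. Let $\tau$ be a finite relational vocabulary whose symbols $R$ have arities $\tau(R)\ge 1$. Formulas of the logic $\mathcal L^{\mathbf A}(\tau)$ are built from atomic formulas $R(x_{1},\ldots,x_{\tau(R)})$ (there is no identity symbol) with a connective for each operation of $\mathbf A$ and the quantifiers $\forall,\exists$. In an $\mathbf A$-valued structure $\mathfrak M=\langle M,R^{\mathfrak M}\rangle_{R\in\tau}$, with $M\neq\emptyset$ and $R^{\mathfrak M}\colon M^{\tau(R)}\to A$, a sentence $\varphi$ has a truth-value $\|\varphi\|^{\mathfrak M}\in A$, where the connectives are interpreted by the operations of $\mathbf A$ and $\forall,\exists$ by infimum and supremum over $M$. For each $R\in\tau$ let $p_R\colon A\to[0,1]$ be a probability distribution, $\sum_{a\in A}p_R(a)=1$. For $n\ge1$, choose a structure $\mathfrak M$ with domain $[n]=\{1,\ldots,n\}$ at random with probability $$\Pr\nolimits_n(\mathfrak M)=\prod_{R\in\tau}\ \prod_{(i_1,\ldots,i_{\tau(R)})\in[n]^{\tau(R)}}p_R\bigl(R^{\mathfrak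 M}(i_1,\ldots,i_{\tau(R)})\bigr),$$ and let $\mu_n(\varphi=a)=\sum\{\Pr_n(\mathfrak M):\|\varphi\|^{\mathfrak M}=a\}$. Then for every sentence $\varphi\in\mathcal L^{\mathbf A}(\tau)$ there is a value $a\in A$, depending only on $\varphi$ and not on the distributions $p_R$, such that for every choice of distributions $(p_R)_{R\in\tau}$ with $p_R(b)>0$ for all $R\in\tau$ and $b\in A$, $a$ is the unique element of $A$ with $\lim_{n\to\infty}\mu_n(\varphi=a)=1$. -/

import Mathlib

open Filter Topology

namespace ManyValued

/-- Formulas whose free variables are among `x_0, …, x_{k-1}`, over a relational vocabulary with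
symbols `τ` of arities `ar`, built from atoms by the lattice connectives, further connectives `C`
of arities `car` (arity `0` being a constant), and the two quantifiers, which bind the variable
`x_k` of a formula in the variables `x_0, …, x_k`. There is no identity symbol. -/
inductive Formula {C τ : Type*} (car : C → ℕ) (ar : τ → ℕ) : ℕ → Type _
  | atom {k : ℕ} (R : τ) (x : Fin (ar R) → Fin k) : Formula car ar k
  | and {k : ℕ} (φ ψ : Formula car ar k) : Formula car ar k
  | or {k : ℕ} (φ ψ : Formula car ar k) : Formula car ar k
  | conn {k : ℕ} (c : C) (φ : Fin (car c) → Formula car ar k) : Formula car ar k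
  | all {k : ℕ} (φ : Formula car ar (k + 1)) : Formula car ar k
  | ex {k : ℕ} (φ : Formula car ar (k + 1)) : Formula car ar k

/-- A sentence is a formula without free variables. -/
abbrev Sentence {C τ : Type*} (car : C → ℕ) (ar : τ → ℕ) := Formula car ar 0

/-- The `A`-valued structures with domain `M`. -/
abbrev Model {τ : Type*} (ar : τ → ℕ) (A M : Type*) := (R : τ) → (Fin (ar R) → M) → A

/-- The truth-value of a formula in an `A`-valued structure with finite non-empty domain, where
`op` interprets the further connectives in the lattice `A`. The quantifiers are infimum and
supremum over the domain. -/
def Formula.value {C τ A M : Type*} [Lattice A] [Fintype M] [Nonempty M]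
    {car : C → ℕ} {ar : τ → ℕ} (op : (c : C) → (Fin (car c) → A) → A) (𝔐 : Model ar A M) :
    {k : ℕ} → Formula car ar k → (Fin k → M) → A
  | _, .atom R x, v => 𝔐 R (fun j => v (x j))
  | _, .and φ ψ, v => φ.value op 𝔐 v ⊓ ψ.value op 𝔐 v
  | _, .or φ ψ, v => φ.value op 𝔐 v ⊔ ψ.value op 𝔐 v
  | _, .conn c φ, v => op c (fun j => (φ j).value op 𝔐 v)
  | _, .all φ, v =>
      Finset.univ.inf' Finset.univ_nonempty (fun m : M => φ.value op 𝔐 (Fin.snoc v m))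
  | _, .ex φ, v =>
      Finset.univ.sup' Finset.univ_nonempty (fun m : M => φ.value op 𝔐 (Fin.snoc v m))

/-- The probability of a single structure with domain of size `n`: the values of the atomic
statements are drawn independently, those of `R(i_1, …, i_r)` with distribution `p R`. -/
def modelProb {τ A : Type*} [Fintype τ] {ar : τ → ℕ} (p : τ → A → ℝ) (n : ℕ)
    (𝔐 : Model ar A (Fin n)) : ℝ :=
  ∏ R : τ, ∏ i : Fin (ar R) → Fin n, p R (𝔐 R i)

/-- `μ_n(φ(i_1, …, i_k) = a)`: the probability that a random structure with domain of size `n`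
gives `φ` the value `a` at the tuple `i`. -/
def mu {C τ A : Type*} [Lattice A] [Fintype A] [DecidableEq A] [Fintype τ] [DecidableEq τ]
    {car : C → ℕ} {ar : τ → ℕ} (op : (c : C) → (Fin (car c) → A) → A) (p : τ → A → ℝ)
    (n : ℕ) [NeZero n] {k : ℕ} (φ : Formula car ar k) (i : Fin k → Fin n) (a : A) : ℝ :=
  ∑ 𝔐 : Model ar A (Fin n) with φ.value op 𝔐 i = a, modelProb p n 𝔐

end ManyValued

/-! Fagin's argument carries over to many truth-values. If two structures realise every one-point
extension of small injective tuples, a back-and-forth argument shows that matching tuples give a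
formula the same value: at a quantifier both sides run over the same set of values, hence have the
same infimum and supremum (`Formula.value_eq_of_partialIso`). As arities are positive, the empty
tuples always match, so a sentence has a single value in all such structures. Almost every random
structure is of this kind. For a fixed tuple and extension, distinct candidates for the new point
depend on disjoint sets of coordinates, so failure is exponentially unlikely
(`sum_omitsExtension_le`), while only polynomially many pairs have to be considered. The value is
read off one fixed structure with the property, hence does not depend on the distributions. -/

namespace ManyValued

/-! ### Extension property and back-and-forth -/

section BackAndForth

variable {C τ A : Type*} {car : C → ℕ} {ar : τ → ℕ}

/-- The nesting depth of the quantifiers of a formula. -/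
def Formula.depth : {k : ℕ} → Formula car ar k → ℕ
  | _, .atom _ _ => 0
  | _, .and φ ψ => max φ.depth ψ.depth
  | _, .or φ ψ => max φ.depth ψ.depth
  | _, .conn _ φ => Finset.univ.sup fun j => (φ j).depth
  | _, .all φ => φ.depth + 1
  | _, .ex φ => φ.depth + 1

/-- The extension property up to size `K`: every abstract one-point extension of the structure
induced on an injective tuple of fewer than `K` elements is realised by a new element. -/
def ExtensionProperty {M : Type*} (K : ℕ) (𝔐 : Model ar A M) : Prop :=
  ∀ k < K, ∀ w : Fin k → M, Function.Injective w → ∀ 𝔑 : Model ar A (Fin (k + 1)),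
    (∀ R x, 𝔑 R (Fin.castSucc ∘ x) = 𝔐 R (w ∘ x)) →
      ∃ m, m ∉ Set.range w ∧
        ∀ R x, 𝔐 R ((Fin.snoc w m : Fin (k + 1) → M) ∘ x) = 𝔑 R x

/-- Two injective tuples induce the same structure on their index set. -/
structure PartialIso {M₁ M₂ : Type*} (𝔐₁ : Model ar A M₁) (𝔐₂ : Model ar A M₂) {j : ℕ}
    (w₁ : Fin j → M₁) (w₂ : Fin j → M₂) : Prop where
  inj_left : Function.Injective w₁
  inj_right : Function.Injective w₂
  map_eq : ∀ R (x : Fin (ar R) → Fin j), 𝔐₁ R (w₁ ∘ x) = 𝔐₂ R (w₂ ∘ x)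

theorem PartialIso.symm {M₁ M₂ : Type*} {𝔐₁ : Model ar A M₁} {𝔐₂ : Model ar A M₂} {j : ℕ}
    {w₁ : Fin j → M₁} {w₂ : Fin j → M₂} (h : PartialIso 𝔐₁ 𝔐₂ w₁ w₂) :
    PartialIso 𝔐₂ 𝔐₁ w₂ w₁ :=
  ⟨h.inj_right, h.inj_left, fun R x => (h.map_eq R x).symm⟩

theorem snoc_injective {M : Type*} {j : ℕ} {w : Fin j → M} (hw : Function.Injective w) {m : M}
    (hm : m ∉ Set.range w) : Function.Injective (Fin.snoc w m : Fin (j + 1) → M) := by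
  intro a b
  induction a using Fin.lastCases with
  | last =>
    induction b using Fin.lastCases with
    | last => simp
    | cast b => intro h; exact absurd ⟨b, by simpa using h.symm⟩ hm
  | cast a =>
    induction b using Fin.lastCases with
    | last => intro h; exact absurd ⟨a, by simpa using h⟩ hm
    | cast b => intro h; simpa using hw (by simpa using h)

theorem snoc_comp_castSucc {M : Type*} {j : ℕ} (w : Fin j → M) (m : M) {ι : Type*}
    (x : ι → Fin j) : (Fin.snoc w m : Fin (j + 1) → M) ∘ Fin.castSucc ∘ x = w ∘ x := by
  ext i; simp

/-- The extension to realise over `w₂` is the one that `m₁` induces over `w₁`; `map_eq` is its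
compatibility with the old points. -/
theorem PartialIso.exists_snoc {M₁ M₂ : Type*} {𝔐₁ : Model ar A M₁} {𝔐₂ : Model ar A M₂} {j : ℕ}
    {w₁ : Fin j → M₁} {w₂ : Fin j → M₂} (h : PartialIso 𝔐₁ 𝔐₂ w₁ w₂) {K : ℕ} (hj : j < K)
    (h₂ : ExtensionProperty K 𝔐₂) {m₁ : M₁} (hm : m₁ ∉ Set.range w₁) :
    ∃ m₂, PartialIso 𝔐₁ 𝔐₂ (Fin.snoc w₁ m₁ : Fin (j + 1) → M₁)
      (Fin.snoc w₂ m₂ : Fin (j + 1) → M₂) := by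
  obtain ⟨m₂, hm₂, H⟩ := h₂ j hj w₂ h.inj_right
    (fun R x => 𝔐₁ R ((Fin.snoc w₁ m₁ : Fin (j + 1) → M₁) ∘ x)) (fun R x => by
      rw [snoc_comp_castSucc, h.map_eq])
  exact ⟨m₂, snoc_injective h.inj_left hm, snoc_injective h.inj_right hm₂,
    fun R x => (H R x).symm⟩

/-- Formulas of quantifier depth at most `d` do not distinguish partially isomorphic tuples of size
at most `K - d` of structures with the extension property up to `K`. -/
theorem Formula.value_eq_of_partialIso [Lattice A] {M₁ M₂ : Type*} [Fintype M₁] [Nonempty M₁]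
    [Fintype M₂] [Nonempty M₂] (op : (c : C) → (Fin (car c) → A) → A) {𝔐₁ : Model ar A M₁}
    {𝔐₂ : Model ar A M₂} {K : ℕ} (h₁ : ExtensionProperty K 𝔐₁) (h₂ : ExtensionProperty K 𝔐₂)
    {k : ℕ} (φ : Formula car ar k) :
    ∀ {j : ℕ} {w₁ : Fin j → M₁} {w₂ : Fin j → M₂}, j + φ.depth ≤ K → PartialIso 𝔐₁ 𝔐₂ w₁ w₂ →
      ∀ s : Fin k → Fin j, φ.value op 𝔐₁ (w₁ ∘ s) = φ.value op 𝔐₂ (w₂ ∘ s) := by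
  -- Both quantifiers reduce to this: the two sides attain the same values. An element of the tuple
  -- is matched by its index, a new one by extending the partial isomorphism.
  have step : ∀ {k : ℕ} {φ : Formula car ar (k + 1)}
      (_ : ∀ {j : ℕ} {w₁ : Fin j → M₁} {w₂ : Fin j → M₂}, j + φ.depth ≤ K →
        PartialIso 𝔐₁ 𝔐₂ w₁ w₂ →
        ∀ s : Fin (k + 1) → Fin j, φ.value op 𝔐₁ (w₁ ∘ s) = φ.value op 𝔐₂ (w₂ ∘ s))
      {j : ℕ} {w₁ : Fin j → M₁} {w₂ : Fin j → M₂}, j + (φ.depth + 1) ≤ K →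
      PartialIso 𝔐₁ 𝔐₂ w₁ w₂ → ∀ s : Fin k → Fin j,
      (∀ m₁, ∃ m₂, φ.value op 𝔐₁ (Fin.snoc (w₁ ∘ s) m₁) =
        φ.value op 𝔐₂ (Fin.snoc (w₂ ∘ s) m₂)) ∧
      (∀ m₂, ∃ m₁, φ.value op 𝔐₁ (Fin.snoc (w₁ ∘ s) m₁) =
        φ.value op 𝔐₂ (Fin.snoc (w₂ ∘ s) m₂)) := by
    intro k φ ih j w₁ w₂ hj h s
    have old : ∀ i, φ.value op 𝔐₁ (Fin.snoc (w₁ ∘ s) (w₁ i)) =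
        φ.value op 𝔐₂ (Fin.snoc (w₂ ∘ s) (w₂ i)) := by
      intro i
      rw [← Fin.comp_snoc, ← Fin.comp_snoc]
      exact ih (by omega) h _
    have new : ∀ m₁ m₂, PartialIso 𝔐₁ 𝔐₂ (Fin.snoc w₁ m₁ : Fin (j + 1) → M₁)
        (Fin.snoc w₂ m₂ : Fin (j + 1) → M₂) →
        φ.value op 𝔐₁ (Fin.snoc (w₁ ∘ s) m₁) = φ.value op 𝔐₂ (Fin.snoc (w₂ ∘ s) m₂) := by
      intro m₁ m₂ h'
      have := ih (by omega) h' (Fin.snoc (Fin.castSucc ∘ s) (Fin.last j))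
      simpa only [Fin.comp_snoc, snoc_comp_castSucc, Fin.snoc_last] using this
    constructor
    · intro m₁
      by_cases hm : m₁ ∈ Set.range w₁
      · obtain ⟨i, rfl⟩ := hm
        exact ⟨_, old i⟩
      · obtain ⟨m₂, h'⟩ := h.exists_snoc (by omega) h₂ hm
        exact ⟨m₂, new _ _ h'⟩
    · intro m₂
      by_cases hm : m₂ ∈ Set.range w₂
      · obtain ⟨i, rfl⟩ := hm
        exact ⟨_, old i⟩
      · obtain ⟨m₁, h'⟩ := h.symm.exists_snoc (by omega) h₁ hm
        exact ⟨m₁, new _ _ h'.symm⟩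
  induction φ with
  | atom R x => intro j w₁ w₂ _ h s; exact h.map_eq R (s ∘ x)
  | and φ ψ ihφ ihψ =>
    intro j w₁ w₂ hj h s
    simp only [depth] at hj
    simp only [value]
    rw [ihφ (by omega) h, ihψ (by omega) h]
  | or φ ψ ihφ ihψ =>
    intro j w₁ w₂ hj h s
    simp only [depth] at hj
    simp only [value]
    rw [ihφ (by omega) h, ihψ (by omega) h]
  | conn c φ ih =>
    intro j w₁ w₂ hj h s
    simp only [depth] at hj
    simp only [value]
    congr 1
    funext i
    have := Finset.le_sup (f := fun j => (φ j).depth) (Finset.mem_univ i)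
    exact ih i (by omega) h s
  | all φ ih =>
    intro j w₁ w₂ hj h s
    simp only [value]
    obtain ⟨forth, back⟩ := step ih hj h s
    apply le_antisymm
    · refine Finset.le_inf' _ _ fun m₂ _ => ?_
      obtain ⟨m₁, e⟩ := back m₂
      exact (Finset.inf'_le _ (Finset.mem_univ m₁)).trans e.le
    · refine Finset.le_inf' _ _ fun m₁ _ => ?_
      obtain ⟨m₂, e⟩ := forth m₁
      exact (Finset.inf'_le _ (Finset.mem_univ m₂)).trans e.ge
  | ex φ ih =>
    intro j w₁ w₂ hj h s
    simp only [value]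
    obtain ⟨forth, back⟩ := step ih hj h s
    apply le_antisymm
    · refine Finset.sup'_le _ _ fun m₁ _ => ?_
      obtain ⟨m₂, e⟩ := forth m₁
      exact e.le.trans (Finset.le_sup' (fun m => φ.value op 𝔐₂ (Fin.snoc (w₂ ∘ s) m))
        (Finset.mem_univ m₂))
    · refine Finset.sup'_le _ _ fun m₂ _ => ?_
      obtain ⟨m₁, e⟩ := back m₂
      exact e.ge.trans (Finset.le_sup' (fun m => φ.value op 𝔐₁ (Fin.snoc (w₁ ∘ s) m))
        (Finset.mem_univ m₁))

/-- Without nullary relation symbols, a sentence has the same value in all structures with the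
extension property up to its quantifier depth. -/
theorem Formula.value_sentence_eq [Lattice A] {M₁ M₂ : Type*} [Fintype M₁] [Nonempty M₁]
    [Fintype M₂] [Nonempty M₂] (op : (c : C) → (Fin (car c) → A) → A) (har : ∀ R, 1 ≤ ar R)
    {𝔐₁ : Model ar A M₁} {𝔐₂ : Model ar A M₂} (φ : Sentence car ar)
    (h₁ : ExtensionProperty φ.depth 𝔐₁) (h₂ : ExtensionProperty φ.depth 𝔐₂)
    (v₁ : Fin 0 → M₁) (v₂ : Fin 0 → M₂) : φ.value op 𝔐₁ v₁ = φ.value op 𝔐₂ v₂ :=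
  φ.value_eq_of_partialIso op h₁ h₂ (by simp)
    ⟨Function.injective_of_subsingleton v₁, Function.injective_of_subsingleton v₂,
      fun R x => (x ⟨0, har R⟩).elim0⟩ id

end BackAndForth

/-! ### Product weights -/

section ProductWeights

variable {I A : Type*} [Fintype I] [DecidableEq I] [Fintype A]

theorem sum_prod_weight (q : I → A → ℝ) (hq : ∀ i, ∑ a, q i a = 1) :
    ∑ f : I → A, ∏ i, q i (f i) = 1 := by
  rw [← Fintype.piFinset_univ, ← Finset.prod_univ_sum]
  simp [hq]

variable [DecidableEq A]

/-- The indicator factors over coordinates, so sum and product interchange; each coordinate outside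
`S` contributes 1. -/
theorem sum_prod_weight_agree (q : I → A → ℝ) (hq : ∀ i, ∑ a, q i a = 1) (g : I → A)
    (S : Finset I) :
    ∑ f : I → A, (∏ i, q i (f i)) * (∏ i ∈ S, if f i = g i then 1 else 0) =
      ∏ i ∈ S, q i (g i) := by
  have h : ∀ f : I → A, (∏ i, q i (f i)) * (∏ i ∈ S, if f i = g i then (1 : ℝ) else 0) =
      ∏ i, q i (f i) * (if i ∈ S then (if f i = g i then 1 else 0) else 1) := by
    intro f
    rw [Finset.prod_mul_distrib, Finset.prod_ite_mem, Finset.univ_inter]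
  simp_rw [h]
  rw [← Fintype.piFinset_univ, ← Finset.prod_univ_sum (fun _ => Finset.univ)
    (fun i a => q i a * (if i ∈ S then (if a = g i then 1 else 0) else 1)),
    ← Finset.univ_inter S, ← Finset.prod_ite_mem]
  refine Finset.prod_congr rfl fun i _ => ?_
  by_cases hi : i ∈ S <;> simp [hi, hq]

/-- For pairwise disjoint blocks of coordinates, the events of disagreeing with `g` somewhere on a
block are independent. -/
theorem sum_prod_weight_disagree {ι : Type*} [DecidableEq ι] (q : I → A → ℝ)
    (hq : ∀ i, ∑ a, q i a = 1) (g : I → A) (T : Finset ι) (S : ι → Finset I)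
    (hS : (T : Set ι).PairwiseDisjoint S) :
    ∑ f : I → A, (∏ i, q i (f i)) *
        ∏ m ∈ T, (1 - ∏ i ∈ S m, if f i = g i then (1 : ℝ) else 0) =
      ∏ m ∈ T, (1 - ∏ i ∈ S m, q i (g i)) := by
  -- Inclusion–exclusion reduces disagreement to agreement on unions of disjoint blocks.
  have expand : ∀ x : ι → ℝ, ∏ m ∈ T, (1 - x m) =
      ∑ U ∈ T.powerset, (-1) ^ U.card * ∏ m ∈ U, x m := by
    intro x
    simp only [sub_eq_add_neg, Finset.prod_one_add, Finset.prod_neg]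
  simp_rw [expand, Finset.mul_sum]
  rw [Finset.sum_comm]
  refine Finset.sum_congr rfl fun U hU => ?_
  have hd : (U : Set ι).PairwiseDisjoint S :=
    hS.subset (by exact_mod_cast Finset.mem_powerset.1 hU)
  simp_rw [← Finset.prod_biUnion hd]
  rw [← sum_prod_weight_agree q hq g, Finset.mul_sum]
  exact Finset.sum_congr rfl fun f _ => by ring

end ProductWeights

/-! ### Random structures -/

section Random

variable {τ A : Type*} {ar : τ → ℕ}

/-- The abstract extension `𝔑` of the structure induced on `w` is not realised in `𝔐`. -/
def OmitsExtension {n k : ℕ} (w : Fin k → Fin n) (𝔑 : Model ar A (Fin (k + 1)))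
    (𝔐 : Model ar A (Fin n)) : Prop :=
  Function.Injective w ∧ (∀ R x, 𝔑 R (Fin.castSucc ∘ x) = 𝔐 R (w ∘ x)) ∧
    ∀ m ∉ Set.range w, ∃ R x, 𝔐 R ((Fin.snoc w m : Fin (k + 1) → Fin n) ∘ x) ≠ 𝔑 R x

theorem exists_omitsExtension {K n : ℕ} {𝔐 : Model ar A (Fin n)} (h : ¬ ExtensionProperty K 𝔐) :
    ∃ z : (k : Fin K) × ((Fin k → Fin n) × Model ar A (Fin (k + 1))),
      OmitsExtension z.2.1 z.2.2 𝔐 := by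
  unfold ExtensionProperty at h
  push Not at h
  obtain ⟨k, hk, w, hw, 𝔑, h𝔑, H⟩ := h
  exact ⟨⟨⟨k, hk⟩, w, 𝔑⟩, hw, h𝔑, H⟩

variable [Fintype τ] {p : τ → A → ℝ}

theorem modelProb_nonneg (hp : ∀ R b, 0 < p R b) (n : ℕ) (𝔐 : Model ar A (Fin n)) :
    0 ≤ modelProb p n 𝔐 :=
  Finset.prod_nonneg fun _ _ => Finset.prod_nonneg fun _ _ => (hp _ _).le

variable [DecidableEq τ] [Fintype A]

/-- Flattens a structure into one family of independent coordinates, the form used for product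
weights. -/
theorem sum_modelProb_mul (p : τ → A → ℝ) (n : ℕ) (F : Model ar A (Fin n) → ℝ) :
    ∑ 𝔐, modelProb p n 𝔐 * F 𝔐 =
      ∑ f : ((R : τ) × (Fin (ar R) → Fin n)) → A, (∏ i, p i.1 (f i)) * F (Sigma.curry f) := by
  refine (Fintype.sum_equiv (Equiv.piCurry fun (R : τ) (_ : Fin (ar R) → Fin n) => A) _ _
    fun f => ?_).symm
  rw [Fintype.prod_sigma]
  rfl

theorem sum_modelProb (h1 : ∀ R, ∑ b, p R b = 1) (n : ℕ) :
    ∑ 𝔐 : Model ar A (Fin n), modelProb p n 𝔐 = 1 := by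
  have := sum_modelProb_mul (ar := ar) p n fun _ => 1
  simp only [mul_one] at this
  rw [this]
  exact sum_prod_weight (fun i : (R : τ) × (Fin (ar R) → Fin n) => p i.1) fun i => h1 i.1

/-- The coordinates of a structure that involve `m` and otherwise only entries of `w`. -/
def extensionBlock (ar : τ → ℕ) {n k : ℕ} (w : Fin k → Fin n) (m : Fin n) :
    Finset ((R : τ) × (Fin (ar R) → Fin n)) :=
  (Finset.univ.filter fun y : (R : τ) × (Fin (ar R) → Fin (k + 1)) =>
    Fin.last k ∈ Set.range y.2).image
      fun y => ⟨y.1, (Fin.snoc w m : Fin (k + 1) → Fin n) ∘ y.2⟩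

theorem disjoint_extensionBlock {n k : ℕ} {w : Fin k → Fin n} {m m' : Fin n}
    (hm : m ∉ Set.range w) (h : m ≠ m') :
    Disjoint (extensionBlock ar w m) (extensionBlock ar w m') := by
  rw [Finset.disjoint_left]
  intro z hz hz'
  simp only [extensionBlock, Finset.mem_image, Finset.mem_filter, Finset.mem_univ,
    true_and] at hz hz'
  obtain ⟨⟨R, x⟩, ⟨i, hi⟩, rfl⟩ := hz
  obtain ⟨⟨R', x'⟩, -, e⟩ := hz'
  obtain ⟨rfl, e⟩ := Sigma.mk.inj_iff.1 e
  have e' := congrFun (eq_of_heq e) i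
  simp only at hi
  simp only [Function.comp_apply, hi, Fin.snoc_last] at e'
  induction hx : x' i using Fin.lastCases with
  | last => rw [hx, Fin.snoc_last] at e'; exact h e'.symm
  | cast j => rw [hx, Fin.snoc_castSucc] at e'; exact hm ⟨j, e'⟩

theorem card_extensionBlock_le {n k : ℕ} (w : Fin k → Fin n) (m : Fin n) :
    (extensionBlock ar w m).card ≤ ∑ R, (k + 1) ^ ar R :=
  Finset.card_image_le.trans ((Finset.card_le_univ _).trans_eq (by simp))

open Classical in
-- Each of the `n - k` candidates realises `𝔑` with probability at least `c ^ L`, independently of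
-- the others.
theorem sum_omitsExtension_le (hp : ∀ R b, 0 < p R b) (h1 : ∀ R, ∑ b, p R b = 1) {c : ℝ}
    (hc : 0 < c) (hc1 : c ≤ 1) (hcp : ∀ R b, c ≤ p R b) {n k : ℕ} (w : Fin k → Fin n)
    (𝔑 : Model ar A (Fin (k + 1))) :
    ∑ 𝔐 with OmitsExtension w 𝔑 𝔐, modelProb p n 𝔐 ≤
      (1 - c ^ (∑ R, (k + 1 : ℕ) ^ ar R)) ^ (n - k) := by
  set L := ∑ R, (k + 1) ^ ar R
  have hcL : c ^ L ≤ 1 := pow_le_one₀ hc.le hc1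
  by_cases hw : Function.Injective w
  swap
  · rw [Finset.filter_false_of_mem fun 𝔐 _ h => hw h.1, Finset.sum_empty]
    exact pow_nonneg (by linarith) _
  have hp1 : ∀ R b, p R b ≤ 1 := fun R b =>
    (h1 R) ▸ Finset.single_le_sum (f := p R) (fun b _ => (hp R b).le) (Finset.mem_univ b)
  -- A common left inverse of all `Fin.snoc w m` with `m` new. Pulling `𝔑` back along it gives a
  -- single target `g` that serves every block.
  let r : Fin n → Fin (k + 1) := fun y =>
    if h : ∃ i, w i = y then Fin.castSucc h.choose else Fin.last k
  have hr : ∀ m ∉ Set.range w, ∀ i, r ((Fin.snoc w m : Fin (k + 1) → Fin n) i) = i := by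
    intro m hm i
    induction i using Fin.lastCases with
    | last =>
      have : ¬ ∃ i, w i = m := hm
      simp [r, this]
    | cast i =>
      have h : ∃ i', w i' = w i := ⟨i, rfl⟩
      simp only [Fin.snoc_castSucc, r, dif_pos h]
      rw [hw h.choose_spec]
  let g : ((R : τ) × (Fin (ar R) → Fin n)) → A := fun y => 𝔑 y.1 (r ∘ y.2)
  let T : Finset (Fin n) := Finset.univ \ Finset.univ.image w
  have hT : ∀ m ∈ T, m ∉ Set.range w := by
    intro m hm
    simpa [T] using hm
  have hTc : T.card = n - k := by
    rw [Finset.card_sdiff_of_subset (Finset.subset_univ _), Finset.card_image_of_injective _ hw]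
    simp
  have key := sum_prod_weight_disagree (fun i : (R : τ) × (Fin (ar R) → Fin n) => p i.1)
    (fun i => h1 i.1) g T (extensionBlock ar w)
    fun m hm m' _ h => disjoint_extensionBlock (hT m hm) h
  -- Indicator that every candidate fails on its own block. It equals 1 on the omitting structures,
  -- and its expectation is a product.
  let F : Model ar A (Fin n) → ℝ := fun 𝔐 =>
    ∏ m ∈ T, (1 - ∏ i ∈ extensionBlock ar w m, if 𝔐 i.1 i.2 = g i then (1 : ℝ) else 0)
  have hF0 : ∀ 𝔐, 0 ≤ F 𝔐 := by
    intro 𝔐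
    refine Finset.prod_nonneg fun m _ => sub_nonneg.2 (Finset.prod_le_one ?_ ?_) <;>
      intro i _ <;> split_ifs <;> norm_num
  have hF1 : ∀ 𝔐, OmitsExtension w 𝔑 𝔐 → F 𝔐 = 1 := by
    rintro 𝔐 ⟨-, hold, hnew⟩
    refine Finset.prod_eq_one fun m hm => ?_
    obtain ⟨R, x, hx⟩ := hnew m (hT m hm)
    have hlast : Fin.last k ∈ Set.range x := by
      by_contra hl
      have hl' : ∀ i, x i ≠ Fin.last k := fun i hi => hl ⟨i, hi⟩
      obtain ⟨x', rfl⟩ : ∃ x' : Fin (ar R) → Fin k, x = Fin.castSucc ∘ x' :=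
        ⟨fun i => (x i).castPred (hl' i), by ext i; simp⟩
      rw [snoc_comp_castSucc, hold] at hx
      exact hx rfl
    rw [Finset.prod_eq_zero (i := ⟨R, (Fin.snoc w m : Fin (k + 1) → Fin n) ∘ x⟩), sub_zero]
    · exact Finset.mem_image.2 ⟨⟨R, x⟩, by simpa using hlast, rfl⟩
    · have : r ∘ (Fin.snoc w m : Fin (k + 1) → Fin n) ∘ x = x :=
        funext fun i => hr m (hT m hm) (x i)
      simp only [g, this]
      exact if_neg hx
  calc ∑ 𝔐 with OmitsExtension w 𝔑 𝔐, modelProb p n 𝔐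
      = ∑ 𝔐 with OmitsExtension w 𝔑 𝔐, modelProb p n 𝔐 * F 𝔐 :=
        Finset.sum_congr rfl fun 𝔐 h => by rw [hF1 𝔐 (Finset.mem_filter.1 h).2, mul_one]
    _ ≤ ∑ 𝔐, modelProb p n 𝔐 * F 𝔐 :=
        Finset.sum_le_univ_sum_of_nonneg fun 𝔐 => mul_nonneg (modelProb_nonneg hp n 𝔐) (hF0 𝔐)
    _ = ∏ m ∈ T, (1 - ∏ i ∈ extensionBlock ar w m, p i.1 (g i)) :=
        (sum_modelProb_mul p n F).trans key
    _ ≤ ∏ _m ∈ T, (1 - c ^ L) := by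
        refine Finset.prod_le_prod (fun m _ => sub_nonneg.2 (Finset.prod_le_one
          (fun i _ => (hp _ _).le) fun i _ => hp1 _ _)) fun m _ => sub_le_sub_left ?_ 1
        calc c ^ L ≤ c ^ (extensionBlock ar w m).card :=
              pow_le_pow_of_le_one hc.le hc1 (card_extensionBlock_le w m)
          _ = ∏ _i ∈ extensionBlock ar w m, c := by rw [Finset.prod_const]
          _ ≤ _ := Finset.prod_le_prod (fun _ _ => hc.le) fun i _ => hcp _ _
    _ = (1 - c ^ L) ^ (n - k) := by rw [Finset.prod_const, hTc]

open Classical in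
-- Union bound over tuples and abstract extensions.
theorem sum_not_extensionProperty_le (hp : ∀ R b, 0 < p R b) (h1 : ∀ R, ∑ b, p R b = 1) {c : ℝ}
    (hc : 0 < c) (hc1 : c ≤ 1) (hcp : ∀ R b, c ≤ p R b) (K n : ℕ) :
    ∑ 𝔐 : Model ar A (Fin n) with ¬ ExtensionProperty K 𝔐, modelProb p n 𝔐 ≤
      ∑ k : Fin K, (n : ℝ) ^ (k : ℕ) * Fintype.card (Model ar A (Fin (k + 1))) *
        (1 - c ^ (∑ R, (k + 1 : ℕ) ^ ar R)) ^ (n - k) := by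
  calc ∑ 𝔐 : Model ar A (Fin n) with ¬ ExtensionProperty K 𝔐, modelProb p n 𝔐
      ≤ ∑ 𝔐 : Model ar A (Fin n),
          ∑ z : (k : Fin K) × ((Fin k → Fin n) × Model ar A (Fin (k + 1))),
            if OmitsExtension z.2.1 z.2.2 𝔐 then modelProb p n 𝔐 else 0 := by
        rw [Finset.sum_filter]
        refine Finset.sum_le_sum fun 𝔐 _ => ?_
        have h0 : ∀ z : (k : Fin K) × ((Fin k → Fin n) × Model ar A (Fin (k + 1))),
            0 ≤ if OmitsExtension z.2.1 z.2.2 𝔐 then modelProb p n 𝔐 else 0 := by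
          intro z
          split_ifs
          exacts [modelProb_nonneg hp n 𝔐, le_rfl]
        split_ifs with h
        · exact Finset.sum_nonneg fun z _ => h0 z
        · obtain ⟨z, hz⟩ := exists_omitsExtension h
          refine le_trans ?_ (Finset.single_le_sum (fun z _ => h0 z) (Finset.mem_univ z))
          rw [if_pos hz]
    _ = ∑ z : (k : Fin K) × ((Fin k → Fin n) × Model ar A (Fin (k + 1))),
          ∑ 𝔐 with OmitsExtension z.2.1 z.2.2 𝔐, modelProb p n 𝔐 := by
        rw [Finset.sum_comm]
        simp_rw [Finset.sum_filter]
    _ ≤ ∑ z : (k : Fin K) × ((Fin k → Fin n) × Model ar A (Fin (k + 1))),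
          (1 - c ^ (∑ R, (z.1 + 1 : ℕ) ^ ar R)) ^ (n - z.1) :=
        Finset.sum_le_sum fun z _ => sum_omitsExtension_le hp h1 hc hc1 hcp z.2.1 z.2.2
    _ = _ := by
        rw [Fintype.sum_sigma]
        refine Finset.sum_congr rfl fun k _ => ?_
        change ∑ _y : (Fin k → Fin n) × Model ar A (Fin (k + 1)),
          (1 - c ^ (∑ R, (k + 1 : ℕ) ^ ar R)) ^ (n - k : ℕ) = _
        rw [Finset.sum_const, Finset.card_univ, nsmul_eq_mul, Fintype.card_prod, Nat.cast_mul, Fintype.card_fun,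
          Fintype.card_fin, Fintype.card_fin, Nat.cast_pow]

theorem tendsto_pow_mul_geometric {r : ℝ} (hr : 0 ≤ r) (hr1 : r < 1) (D : ℝ) (k : ℕ) :
    Tendsto (fun n : ℕ => (n : ℝ) ^ k * D * r ^ (n - k)) atTop (𝓝 0) := by
  rcases hr.eq_or_lt with rfl | hr
  -- The base 0 does occur: `c = 1` when `A` has one element.
  · refine tendsto_const_nhds.congr' ?_
    filter_upwards [eventually_gt_atTop k] with n hn
    rw [zero_pow (by omega), mul_zero]
  · have h := (tendsto_pow_const_mul_const_pow_of_lt_one k hr.le hr1).const_mul (D / r ^ k)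
    rw [mul_zero] at h
    refine h.congr' ?_
    filter_upwards [eventually_ge_atTop k] with n hn
    rw [pow_sub₀ r hr.ne' hn]
    ring

open Classical in
/-- Almost all random structures have the extension property up to a given size. -/
theorem tendsto_sum_extensionProperty (hp : ∀ R b, 0 < p R b) (h1 : ∀ R, ∑ b, p R b = 1) (K : ℕ) :
    Tendsto (fun n : ℕ => ∑ 𝔐 : Model ar A (Fin (n + 1)) with ExtensionProperty K 𝔐,
      modelProb p (n + 1) 𝔐) atTop (𝓝 1) := by
  obtain ⟨c, hc, hc1, hcp⟩ : ∃ c : ℝ, 0 < c ∧ c ≤ 1 ∧ ∀ R b, c ≤ p R b := by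
    -- The extra point `none`, with value 1, ensures `c ≤ 1` and a minimum even when `τ` is empty.
    obtain ⟨z, hz⟩ := Finite.exists_min fun z : Option (τ × A) => z.elim 1 fun y => p y.1 y.2
    refine ⟨_, ?_, hz none, fun R b => hz (some (R, b))⟩
    cases z
    exacts [one_pos, hp _ _]
  have hbad : Tendsto (fun n : ℕ => ∑ 𝔐 : Model ar A (Fin n) with ¬ ExtensionProperty K 𝔐,
      modelProb p n 𝔐) atTop (𝓝 0) := by
    refine squeeze_zero (fun n => Finset.sum_nonneg fun 𝔐 _ => modelProb_nonneg hp n 𝔐)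
      (fun n => sum_not_extensionProperty_le hp h1 hc hc1 hcp K n) ?_
    rw [← Finset.sum_const_zero (s := (Finset.univ : Finset (Fin K)))]
    refine tendsto_finsetSum _ fun k _ => tendsto_pow_mul_geometric ?_ ?_ _ _
    · exact sub_nonneg.2 (pow_le_one₀ hc.le hc1)
    · exact sub_lt_self _ (pow_pos hc _)
  have := ((tendsto_add_atTop_iff_nat 1).2 hbad).const_sub 1
  rw [sub_zero] at this
  refine this.congr fun n => ?_
  rw [← sum_modelProb (ar := ar) h1 (n + 1),
    ← Finset.sum_filter_add_sum_filter_not Finset.univ (ExtensionProperty K)]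
  ring

/-- Under the uniform distribution the property has positive probability for some size. -/
theorem exists_extensionProperty [Nonempty A] (ar : τ → ℕ) (K : ℕ) :
    ∃ (n : ℕ) (𝔐 : Model ar A (Fin (n + 1))), ExtensionProperty K 𝔐 := by
  classical
  have h := tendsto_sum_extensionProperty (ar := ar)
    (p := fun (_ : τ) (_ : A) => (Fintype.card A : ℝ)⁻¹)
    (fun _ _ => by positivity) (fun _ => by simp) K
  obtain ⟨n, hn⟩ := (h.eventually_ne one_ne_zero).exists
  obtain ⟨𝔐, h𝔐, -⟩ := Finset.exists_ne_zero_of_sum_ne_zero hn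
  exact ⟨n, 𝔐, (Finset.mem_filter.1 h𝔐).2⟩

theorem mu_add_mu_le_one [Lattice A] [DecidableEq A] {C : Type*} {car : C → ℕ}
    (op : (c : C) → (Fin (car c) → A) → A) (hp : ∀ R b, 0 < p R b)
    (h1 : ∀ R, ∑ b, p R b = 1) (n : ℕ) [NeZero n] {k : ℕ} (φ : Formula car ar k)
    (i : Fin k → Fin n) {a b : A} (hab : a ≠ b) : mu op p n φ i a + mu op p n φ i b ≤ 1 := by
  rw [mu, mu, ← Finset.sum_union]
  · rw [← sum_modelProb (ar := ar) h1 n]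
    exact Finset.sum_le_univ_sum_of_nonneg fun 𝔐 => modelProb_nonneg hp n 𝔐
  · rw [Finset.disjoint_filter]
    rintro 𝔐 - h h'
    exact hab (h.symm.trans h')

end Random

end ManyValued

/-- For a finite lattice algebra `A` and a finite relational vocabulary `τ`, every sentence has one
almost sure value `a`, the same for all strictly positive atomic distributions: for each of them,
`a` is the only truth-value whose probability tends to `1` as the size of the domain grows. -/
theorem mainTheorem4 {A : Type*} [Lattice A] [Fintype A] [DecidableEq A] [Nonempty A]
    {C : Type*} {car : C → ℕ} (op : (c : C) → (Fin (car c) → A) → A)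
    {τ : Type*} [Fintype τ] [DecidableEq τ] {ar : τ → ℕ} (har : ∀ R, 1 ≤ ar R)
    (φ : ManyValued.Sentence car ar) :
    ∃ a : A, ∀ p : τ → A → ℝ, (∀ R b, 0 < p R b) → (∀ R, ∑ b, p R b = 1) →
      ∀ b : A, Tendsto (fun n : ℕ => ManyValued.mu op p (n + 1) φ Fin.elim0 b) atTop (𝓝 1) ↔
        b = a := by
  classical
  obtain ⟨N, 𝔐₀, h₀⟩ := ManyValued.exists_extensionProperty (A := A) ar φ.depth
  refine ⟨φ.value op 𝔐₀ Fin.elim0, fun p hp h1 b => ?_⟩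
  have lim : Tendsto (fun n : ℕ => ManyValued.mu op p (n + 1) φ Fin.elim0
      (φ.value op 𝔐₀ Fin.elim0)) atTop (𝓝 1) := by
    refine tendsto_of_tendsto_of_tendsto_of_le_of_le
      (ManyValued.tendsto_sum_extensionProperty (ar := ar) hp h1 φ.depth) tendsto_const_nhds
      (fun n => ?_) fun n => ?_
    · refine Finset.sum_le_sum_of_subset_of_nonneg (fun 𝔐 h => ?_)
        fun 𝔐 _ _ => ManyValued.modelProb_nonneg hp _ 𝔐
      rw [Finset.mem_filter] at h ⊢
      exact ⟨h.1, φ.value_sentence_eq op har h.2 h₀ _ _⟩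
    · rw [← ManyValued.sum_modelProb (ar := ar) h1 (n + 1)]
      exact Finset.sum_le_univ_sum_of_nonneg fun 𝔐 => ManyValued.modelProb_nonneg hp _ 𝔐
  refine ⟨fun hb => ?_, fun hb => hb ▸ lim⟩
  by_contra hne
  -- Two distinct almost sure values would give `1 + 1 ≤ 1` in the limit.
  have := le_of_tendsto' (hb.add lim) fun n =>
    ManyValued.mu_add_mu_le_one op hp h1 (n + 1) φ Fin.elim0 hne
  norm_num at this
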